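/- Write $\mathbb T^d=\mathbb R^d/\mathbb Z^d$ and $\mathbb T=\mathbb R/\mathbb Z$. For an open set $\Omega\subseteq\mathbb T^d$ let $\mathcal F^*(\Omega)$ be the set of continuous functions $f:\mathbb T^d\to\mathbb R$ with closed support $\operatorname{supp} f\subseteq\Omega$, $f(0)=1$ and $\widehat f(n)\ge 0$ for all $n\in\mathbb Z^d$, and for $z\in\mathbb T^d$ put $$\mathcal M^*(\Omega,z)=\sup_{f\in\mathcal F^*(\Omega)} f(z),\qquad \mathcal Z(z)=\{nz : n\in\mathbb Z\}\subseteq\mathbb T^d,$$ $$H(\Omega,z)=\{k\in\mathbb N : k\ge 2,\ kz\in\Omega,\ -kz\in\Omega\},\qquad H_m(\Omega,z)=H(\Omega,z)\cap[2,m/2].$$ For a set $H$ of integers $\ge 2$ let * $M(H)$ be the supremum of all $\lambda\in\mathbb R$ for which there are real numbers $c_k$ and an integrable function $\varphi\ge 0$ on $\mathbb T$ with Fourier series $\varphi(t)\sim 1+\lambda\cos 2\pi t+\sum_{k\in H}c_k\cos 2\pi kt$; * $M_m(H)$ be the supremum in $(-\infty,\infty]$ of all $\lambda\in\mathbb R$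 for which there are real numbers $c_k$ and a function $\varphi(t)=1+\lambda\cos 2\pi t+\sum_{k\in H}c_k\cos 2\pi kt$ on $\mathbb T$ (with unconditional pointwise convergence if $H$ is infinite) such that $\varphi(j/m)\ge 0$ for all $j\in\mathbb Z$. **Theorem.** Let $\Omega\subseteq\mathbb T^d$ be open with $0\in\Omega$, let $z\in\Omega\cap(-\Omega)$, and write $\mathcal Z=\mathcal Z(z)$. 1. The value $\mathcal M^*(\Omega,z)$ depends on what happens on the orbit $\mathcal Z$ only: if $\Omega'\subseteq\mathbb T^d$ is open and $\Omega'\cap(-\Omega')\cap\mathcal Z=\Omega\cap(-\Omega)\cap\mathcal Z$, then $\mathcal M^*(\Omega',z)=\mathcal M^*(\Omega,z)$. Moreover, if $\mathcal Z$ is infinite and $\mathcal Z(z')=\mathcal Z$, then $\mathcal M^*(\Omega,z')=\mathcal M^*(\Omega,z)$. 2. If $\mathcal Z$ is infinite, then $\mathcal M^*(\Omega,z)=\tfrac12 M(H(\Omega,z))$. 3. If $\mathcal Z$ is finite with $\#\mathcal Z=m\ge 3$, then $\mathcal M^*(\Omega,z)=\tfrac12 M_m(H_m(\Omega,z))$.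 4. If $\#\mathcal Z\le 2$ (that is, $2z=0$), then $\mathcal M^*(\Omega,z)=1$. -/

import Mathlib

open scoped Pointwise

noncomputable section

/-- The functions `f` on the torus `𝕋^d = (ℝ/ℤ)^d` admissible for `Ω`: real valued, continuous,
with (closed) support contained in `Ω`, normalized by `f 0 = 1`, and positive definite, that is,
all Fourier coefficients of `f` are real and nonnegative. -/
structure IsTorusAdmissible {d : ℕ} (Ω : Set (UnitAddTorus (Fin d)))
    (f : UnitAddTorus (Fin d) → ℝ) : Prop where
  continuous : Continuous f
  tsupport_subset : tsupport f ⊆ Ω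
  map_zero : f 0 = 1
  coeff_re_nonneg : ∀ n : Fin d → ℤ,
    0 ≤ (UnitAddTorus.mFourierCoeff (fun x => (f x : ℂ)) n).re
  coeff_im_eq_zero : ∀ n : Fin d → ℤ,
    (UnitAddTorus.mFourierCoeff (fun x => (f x : ℂ)) n).im = 0

/-- The pointwise extremal value `𝓜*(Ω, z)`, the supremum of `f z` over all admissible `f`. -/
def torusExtremal {d : ℕ} (Ω : Set (UnitAddTorus (Fin d))) (z : UnitAddTorus (Fin d)) : EReal :=
  ⨆ (f : UnitAddTorus (Fin d) → ℝ) (_ : IsTorusAdmissible Ω f), (f z : EReal)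

/-- The orbit `𝒵(z) = {n z : n ∈ ℤ}` in the torus. -/
def torusOrbit {d : ℕ} (z : UnitAddTorus (Fin d)) : Set (UnitAddTorus (Fin d)) :=
  Set.range fun n : ℤ => n • z

/-- `H(Ω, z)`, the set of integers `k ≥ 2` with `k z ∈ Ω` and `- k z ∈ Ω` in the torus. -/
def multipleIndexSet {d : ℕ} (Ω : Set (UnitAddTorus (Fin d))) (z : UnitAddTorus (Fin d)) : Set ℕ :=
  {k | 2 ≤ k ∧ k • z ∈ Ω ∧ -(k • z) ∈ Ω}

/-- `H_m(Ω, z) = H(Ω, z) ∩ [2, m/2]`. -/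
def truncatedMultipleIndexSet {d : ℕ} (m : ℕ) (Ω : Set (UnitAddTorus (Fin d)))
    (z : UnitAddTorus (Fin d)) : Set ℕ :=
  {k | k ∈ multipleIndexSet Ω z ∧ (k : ℝ) ≤ (m : ℝ) / 2}

/-- `φ ∈ Φ(H)` with coefficients `lam` and `c`: the integrable function `φ ≥ 0` on `𝕋 = ℝ/ℤ` has
the Fourier series `1 + lam cos 2πt + ∑_{k ∈ H} c_k cos 2πkt` (here `H ⊆ {2, 3, …}`), so that its
coefficients at the frequencies `0`, `± 1`, `± k` are `1`, `lam / 2`, `c_k / 2`. -/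
structure MemPhi (H : Set ℕ) (φ : UnitAddCircle → ℝ) (lam : ℝ) (c : ℕ → ℝ) : Prop where
  integrable : MeasureTheory.Integrable φ
  nonneg : ∀ t, 0 ≤ φ t
  support_subset : ∀ k, k ∉ H → c k = 0
  coeff_zero : fourierCoeff (fun t => (φ t : ℂ)) 0 = 1
  coeff_one : ∀ n : ℤ, n.natAbs = 1 →
    fourierCoeff (fun t => (φ t : ℂ)) n = ((lam / 2 : ℝ) : ℂ)
  coeff_of_two_le : ∀ n : ℤ, 2 ≤ n.natAbs →
    fourierCoeff (fun t => (φ t : ℂ)) n = ((c n.natAbs / 2 : ℝ) : ℂ)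

/-- The Carathéodory–Fejér type extremal value `M(H)`. -/
def trigExtremal (H : Set ℕ) : EReal :=
  sSup {x : EReal | ∃ (φ : UnitAddCircle → ℝ) (lam : ℝ) (c : ℕ → ℝ),
    MemPhi H φ lam c ∧ x = (lam : EReal)}

/-- `φ ∈ Φ_m(H)` with coefficients `lam` and `c`: `φ` is the sum of the (unconditionally
convergent, finite if `H` is) series `1 + lam cos 2πt + ∑_{k ∈ H} c_k cos 2πkt`, and `φ` is
nonnegative at the points `j/m`, `j ∈ ℤ`. -/
structure MemPhiDiscrete (m : ℕ) (H : Set ℕ) (φ : UnitAddCircle → ℝ) (lam : ℝ) (c : ℕ → ℝ) :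
    Prop where
  hasSum : ∀ t : ℝ, HasSum (fun k : H => c k * Real.cos (2 * Real.pi * (k : ℕ) * t))
    (φ (t : UnitAddCircle) - (1 + lam * Real.cos (2 * Real.pi * t)))
  nonneg : ∀ j : ℤ, 0 ≤ φ (((j : ℝ) / (m : ℝ) : ℝ) : UnitAddCircle)

/-- The discretized extremal value `M_m(H)`; it may be infinite. -/
def trigExtremalDiscrete (m : ℕ) (H : Set ℕ) : EReal :=
  sSup {x : EReal | ∃ (φ : UnitAddCircle → ℝ) (lam : ℝ) (c : ℕ → ℝ),
    MemPhiDiscrete m H φ lam c ∧ x = (lam : EReal)}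

end

/-! An admissible `f` has an absolutely convergent Fourier series with nonnegative coefficients, so
it is even and `k ↦ f (k • z)` is an even positive definite sequence on `ℤ`, equal to `1` at `0` and
vanishing where `k • z ∉ Ω ∩ -Ω`. Its Fejér means are nonnegative cosine polynomials with spectrum
in `{0, 1} ∪ H` and first coefficient `2 (1 - 1/N) f z`. This gives `2 f z ≤ M(H)` as `N → ∞`.

Conversely, the Fejér means of a competitor `φ` are cosine polynomials. Their coefficients serve as
masses at the points `± k • z`, and this measure is convolved with a positive definite bump of tiny
support (`exists_isTorusAdmissible`). The `n`-th Fourier coefficient of the result is that of the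
bump times the polynomial evaluated at the angle of the character `n` at `z`, hence nonnegative; its
value at `z` is half the first coefficient of the polynomial.

If `z` has order `m ≥ 3`, the sequence is `m`-periodic and all angles lie in `(1/m)ℤ/ℤ`. Summing
over one period replaces the Fejér means, no limit is needed, and nonnegativity matters only at
`j/m`. As `k` and `m - k` give the same pair `± k • z`, frequencies up to `m/2` suffice.

The formulas involve `Ω` only through the multiples of `z` in `Ω ∩ -Ω`, which gives the dependence
on the orbit alone. -/

open MeasureTheory ComplexConjugate

/-! ### Fourier series of admissible functions on the torus -/

section

namespace UnitAddTorus

variable {d : ℕ}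

/-- The normalized Haar measure on the torus `𝕋^d`. -/
noncomputable def torusMeasure (d : ℕ) : Measure (UnitAddTorus (Fin d)) :=
  Measure.pi fun _ => AddCircle.haarAddCircle

instance : IsProbabilityMeasure (torusMeasure d) := by
  unfold torusMeasure; infer_instance

instance : (torusMeasure d).IsAddRightInvariant := by
  unfold torusMeasure; infer_instance

instance : (torusMeasure d).IsOpenPosMeasure := by
  unfold torusMeasure; infer_instance

theorem mFourierCoeff_eq_integral_torusMeasure (f : UnitAddTorus (Fin d) → ℂ) (n : Fin d → ℤ) :
    mFourierCoeff f n = ∫ x, mFourier (-n) x * f x ∂torusMeasure d := rfl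

/-- The angle `∑ i, n i • x i` of the character `mFourier n` at `x`. -/
noncomputable def angle (n : Fin d → ℤ) : UnitAddTorus (Fin d) →+ UnitAddCircle where
  toFun x := ∑ i, n i • x i
  map_zero' := by simp
  map_add' x y := by simp [Finset.sum_add_distrib]

theorem mFourier_eq_fourier_one_angle (n : Fin d → ℤ) (x : UnitAddTorus (Fin d)) :
    mFourier n x = fourier 1 (angle n x) := by
  have h (s : Finset (Fin d)) :
      ∏ i ∈ s, fourier (n i) (x i) = fourier 1 (∑ i ∈ s, n i • x i) := by
    classical
    induction s using Finset.induction_on with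
    | empty => simp
    | insert a s ha ih =>
      rw [Finset.prod_insert ha, Finset.sum_insert ha, ih]
      simp [fourier_apply, AddCircle.toCircle_add]
  exact h Finset.univ

theorem mFourier_zsmul (n : Fin d → ℤ) (k : ℤ) (x : UnitAddTorus (Fin d)) :
    mFourier n (k • x) = fourier k (angle n x) := by
  rw [mFourier_eq_fourier_one_angle, map_zsmul]
  simp [fourier_apply]

theorem mFourier_apply_add (n : Fin d → ℤ) (x y : UnitAddTorus (Fin d)) :
    mFourier n (x + y) = mFourier n x * mFourier n y := by
  simp [mFourier_eq_fourier_one_angle, fourier_apply, AddCircle.toCircle_add]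

theorem mFourier_apply_neg (n : Fin d → ℤ) (x : UnitAddTorus (Fin d)) :
    mFourier n (-x) = conj (mFourier n x) := by
  rw [← mFourier_neg, mFourier_eq_fourier_one_angle, mFourier_eq_fourier_one_angle]
  simp [angle]

theorem norm_mFourier_apply (n : Fin d → ℤ) (x : UnitAddTorus (Fin d)) :
    ‖mFourier n x‖ = 1 := by
  rw [mFourier_eq_fourier_one_angle, fourier_apply, Circle.norm_coe]

theorem mFourier_apply_zero (n : Fin d → ℤ) :
    mFourier n (0 : UnitAddTorus (Fin d)) = 1 := by
  simp [mFourier_eq_fourier_one_angle]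

theorem integral_mFourier (n : Fin d → ℤ) :
    ∫ x, mFourier n x ∂torusMeasure d = if n = 0 then 1 else 0 := by
  have h := orthonormal_iff_ite.mp (orthonormal_mFourier (d := Fin d)) 0 n
  simp only [ContinuousMap.inner_toLp, ← mFourier_neg, ← mFourier_add] at h
  simpa [eq_comm] using! h

theorem integrable_torusMeasure {E : Type*} [NormedAddCommGroup E]
    {f : UnitAddTorus (Fin d) → E} (hf : Continuous f) : Integrable f (torusMeasure d) :=
  hf.integrable_of_hasCompactSupport (HasCompactSupport.of_compactSpace f)

theorem sum_mul_conj_eq_norm_sq {ι : Type*} (s : Finset ι) (u : ι → ℂ) :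
    ∑ j ∈ s, ∑ l ∈ s, u j * conj (u l) = ((‖∑ j ∈ s, u j‖ ^ 2 : ℝ) : ℂ) := by
  rw [← Finset.sum_mul_sum, ← map_sum, Complex.mul_conj, Complex.normSq_eq_norm_sq]

theorem sum_mFourierCoeff_sub (f : UnitAddTorus (Fin d) → ℝ) (hf : Continuous f)
    (J : Finset (Fin d → ℤ)) :
    ∑ j ∈ J, ∑ l ∈ J, mFourierCoeff (fun x => (f x : ℂ)) (j - l) =
      ((∫ x, f x * ‖∑ j ∈ J, mFourier (-j) x‖ ^ 2 ∂torusMeasure d : ℝ) : ℂ) := by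
  simp_rw [mFourierCoeff_eq_integral_torusMeasure]
  have hi (j l : Fin d → ℤ) :
      Integrable (fun x => mFourier (-(j - l)) x * (f x : ℂ)) (torusMeasure d) :=
    integrable_torusMeasure (by fun_prop)
  rw [← integral_complex_ofReal]
  rw [← Finset.sum_congr rfl fun j _ => integral_finsetSum J fun l _ => hi j l,
    ← integral_finsetSum J fun j _ => integrable_finsetSum J fun l _ => hi j l]
  congr 1
  ext x
  rw [Complex.ofReal_mul, ← sum_mul_conj_eq_norm_sq, Finset.mul_sum]
  refine Finset.sum_congr rfl fun j _ => ?_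
  rw [Finset.mul_sum]
  refine Finset.sum_congr rfl fun l _ => ?_
  rw [← mFourier_neg, ← mFourier_add, mul_comm]
  congr 3
  abel

theorem integral_norm_sum_mFourier_sq (J : Finset (Fin d → ℤ)) :
    ∫ x, ‖∑ j ∈ J, mFourier (-j) x‖ ^ 2 ∂torusMeasure d = J.card := by
  have h := sum_mFourierCoeff_sub (fun _ => (1 : ℝ)) continuous_const J
  simp_rw [mFourierCoeff_eq_integral_torusMeasure] at h
  simp only [Complex.ofReal_one, mul_one, integral_mFourier, one_mul, neg_eq_zero, sub_eq_zero]
    at h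
  simp only [Finset.sum_ite_eq, Finset.sum_ite_mem, Finset.inter_self, Finset.sum_const,
    nsmul_eq_mul, mul_one] at h
  exact_mod_cast h.symm

/-- Double counting: if `S` lies in the box of radius `M`, every `n ∈ S` is a difference `j - l`
within the box of radius `2M` for at least `(2M+1)^d` pairs. The sum over all pairs is the integral
of `f` against a nonnegative weight of total mass `(4M+1)^d`, and `4M+1 ≤ 2(2M+1)`. -/
theorem sum_mFourierCoeff_re_le {f : UnitAddTorus (Fin d) → ℝ} (hf : Continuous f)
    (hpos : ∀ n, 0 ≤ (mFourierCoeff (fun x => (f x : ℂ)) n).re) {C : ℝ} (hC : ∀ x, f x ≤ C)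
    (S : Finset (Fin d → ℤ)) :
    ∑ n ∈ S, (mFourierCoeff (fun x => (f x : ℂ)) n).re ≤ |C| * 2 ^ d := by
  set r : (Fin d → ℤ) → ℝ := fun n => (mFourierCoeff (fun x => (f x : ℂ)) n).re
  let box (M : ℕ) : Finset (Fin d → ℤ) := Fintype.piFinset fun _ => Finset.Icc (-(M : ℤ)) M
  have hcard (M : ℕ) : (box M).card = (2 * M + 1) ^ d := by
    simp only [box, Fintype.card_piFinset, Int.card_Icc, Finset.prod_const, Finset.card_univ,
      Fintype.card_fin]
    congr 1
    omega
  obtain ⟨M, hM⟩ : ∃ M : ℕ, S ⊆ box M := by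
    refine ⟨∑ n ∈ S, ∑ i, (n i).natAbs, fun n hn => ?_⟩
    simp only [box, Fintype.mem_piFinset, Finset.mem_Icc]
    intro i
    have h1 : (n i).natAbs ≤ ∑ i, (n i).natAbs :=
      Finset.single_le_sum (f := fun i => (n i).natAbs) (fun _ _ => zero_le) (Finset.mem_univ i)
    have h2 : ∑ i, (n i).natAbs ≤ ∑ n ∈ S, ∑ i, (n i).natAbs :=
      Finset.single_le_sum (f := fun n : Fin d → ℤ => ∑ i, (n i).natAbs)
        (fun _ _ => zero_le) hn
    omega
  have h1 : ∑ j ∈ box M, ∑ n ∈ S, r n ≤ ∑ j ∈ box (2 * M), ∑ l ∈ box (2 * M), r (j - l) := by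
    refine (Finset.sum_le_sum fun j hj => ?_).trans
      (Finset.sum_le_sum_of_subset_of_nonneg (s := box M) ?_ fun j _ _ =>
        Finset.sum_nonneg fun l _ => hpos _)
    · have himage : ∑ n ∈ S, r n = ∑ l ∈ S.image (fun n => j - n), r (j - l) := by
        rw [Finset.sum_image (by simp)]
        simp
      rw [himage]
      refine Finset.sum_le_sum_of_subset_of_nonneg ?_ fun l _ _ => hpos _
      intro l hl
      obtain ⟨n, hn, rfl⟩ := Finset.mem_image.mp hl
      have := hM hn
      simp only [box, Fintype.mem_piFinset, Finset.mem_Icc, Pi.sub_apply] at this hj ⊢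
      intro i
      have a1 := this i
      have a2 := hj i
      push_cast
      omega
    · intro j hj
      simp only [box, Fintype.mem_piFinset, Finset.mem_Icc] at hj ⊢
      intro i
      have := hj i
      push_cast
      omega
  have h2 : ∑ j ∈ box (2 * M), ∑ l ∈ box (2 * M), r (j - l) ≤ C * (box (2 * M)).card := by
    have := congrArg Complex.re (sum_mFourierCoeff_sub f hf (box (2 * M)))
    simp only [Complex.re_sum, Complex.ofReal_re] at this
    rw [this, ← integral_norm_sum_mFourier_sq, ← integral_const_mul]
    refine integral_mono (integrable_torusMeasure (by fun_prop))
      (integrable_torusMeasure (by fun_prop)) fun x => ?_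
    exact mul_le_mul_of_nonneg_right (hC x) (by positivity)
  rw [Finset.sum_const, nsmul_eq_mul, hcard] at h1
  rw [hcard] at h2
  have h3 : ((2 * M + 1 : ℕ) : ℝ) ^ d * ∑ n ∈ S, r n ≤
      ((2 * M + 1 : ℕ) : ℝ) ^ d * (|C| * 2 ^ d) := by
    push_cast at h1 h2 ⊢
    calc _ ≤ C * (2 * (2 * M) + 1 : ℝ) ^ d := h1.trans h2
      _ ≤ |C| * ((2 * M + 1) * 2 : ℝ) ^ d :=
        mul_le_mul (le_abs_self C) (pow_le_pow_left₀ (by positivity) (by linarith) d)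
          (by positivity) (abs_nonneg C)
      _ = _ := by rw [mul_pow]; ring
  exact le_of_mul_le_mul_left h3 (by positivity)

end UnitAddTorus

namespace IsTorusAdmissible

open UnitAddTorus

variable {d : ℕ} {Ω : Set (UnitAddTorus (Fin d))} {f : UnitAddTorus (Fin d) → ℝ}

theorem coeff_eq_re (hf : IsTorusAdmissible Ω f) (n : Fin d → ℤ) :
    mFourierCoeff (fun x => (f x : ℂ)) n = ((mFourierCoeff (fun x => (f x : ℂ)) n).re : ℂ) :=
  Complex.ext (by simp) (by simp [hf.coeff_im_eq_zero n])

theorem summable_coeff (hf : IsTorusAdmissible Ω f) :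
    Summable (mFourierCoeff (fun x => (f x : ℂ))) := by
  obtain ⟨C, hC⟩ := (isCompact_range hf.continuous).bddAbove
  have h : Summable fun n => (mFourierCoeff (fun x => (f x : ℂ)) n).re :=
    summable_of_sum_le hf.coeff_re_nonneg
      (sum_mFourierCoeff_re_le hf.continuous hf.coeff_re_nonneg fun x => hC ⟨x, rfl⟩)
  rw [funext hf.coeff_eq_re]
  exact Complex.ofRealCLM.summable h

/-- The Fourier series of an admissible function. -/
theorem hasSum_coeff_mul_re (hf : IsTorusAdmissible Ω f) (x : UnitAddTorus (Fin d)) :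
    HasSum (fun n => (mFourierCoeff (fun x => (f x : ℂ)) n).re * (mFourier n x).re) (f x) := by
  have h := hasSum_mFourier_series_apply_of_summable
    (f := ⟨fun x => (f x : ℂ), by have := hf.continuous; fun_prop⟩) hf.summable_coeff x
  have h' := Complex.hasSum_re h
  refine (h'.congr_fun ?_)
  intro n
  simp only [ContinuousMap.coe_mk, smul_eq_mul]
  rw [hf.coeff_eq_re n, Complex.re_ofReal_mul, Complex.ofReal_re]

theorem map_neg (hf : IsTorusAdmissible Ω f) (x : UnitAddTorus (Fin d)) : f (-x) = f x := by
  refine (hf.hasSum_coeff_mul_re (-x)).unique ?_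
  simpa [mFourier_apply_neg] using hf.hasSum_coeff_mul_re x

theorem le_one (hf : IsTorusAdmissible Ω f) (x : UnitAddTorus (Fin d)) : f x ≤ 1 := by
  rw [← hf.map_zero]
  refine hasSum_le (fun n => ?_) (hf.hasSum_coeff_mul_re x) (hf.hasSum_coeff_mul_re 0)
  refine mul_le_mul_of_nonneg_left ?_ (hf.coeff_re_nonneg n)
  rw [mFourier_apply_zero, Complex.one_re]
  exact (Complex.re_le_norm _).trans (norm_mFourier_apply n x).le

/-- Evenness of `f` is what replaces `Ω` by `Ω ∩ -Ω`. -/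
theorem eq_zero_of_notMem (hf : IsTorusAdmissible Ω f) {x : UnitAddTorus (Fin d)}
    (hx : ¬ (x ∈ Ω ∧ -x ∈ Ω)) : f x = 0 := by
  by_contra h
  exact hx ⟨hf.tsupport_subset (subset_tsupport f h),
    hf.tsupport_subset (subset_tsupport f (by rwa [Function.mem_support, hf.map_neg]))⟩

end IsTorusAdmissible

end

/-! ### Positive definite bumps and the construction of admissible functions -/

section

namespace UnitAddTorus

variable {d : ℕ}

theorem mFourierCoeff_autocorrelation {g : UnitAddTorus (Fin d) → ℝ} (hg : Continuous g)
    (n : Fin d → ℤ) :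
    mFourierCoeff (fun x => ((∫ y, g (x + y) * g y ∂torusMeasure d : ℝ) : ℂ)) n =
      ((‖mFourierCoeff (fun x => (g x : ℂ)) n‖ ^ 2 : ℝ) : ℂ) := by
  have key (x y : UnitAddTorus (Fin d)) :
      mFourier (-n) x * ((g (x + y) * g y : ℝ) : ℂ) =
        (mFourier (-n) (x + y) * (g (x + y) : ℂ)) * conj (mFourier (-n) y * (g y : ℂ)) := by
    have h1 : mFourier (-n) y * conj (mFourier (-n) y) = 1 := by
      rw [Complex.mul_conj, Complex.normSq_eq_norm_sq, norm_mFourier_apply]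
      simp
    rw [mFourier_apply_add, map_mul, Complex.conj_ofReal]
    push_cast
    linear_combination (-mFourier (-n) x * g (x + y) * g y) * h1
  have hint : Integrable (Function.uncurry fun x y =>
      (mFourier (-n) (x + y) * (g (x + y) : ℂ)) * conj (mFourier (-n) y * (g y : ℂ)))
      ((torusMeasure d).prod (torusMeasure d)) := by
    refine Continuous.integrable_of_hasCompactSupport ?_ (HasCompactSupport.of_compactSpace _)
    unfold Function.uncurry
    fun_prop
  simp_rw [mFourierCoeff_eq_integral_torusMeasure]
  calc _ = ∫ x, ∫ y, (mFourier (-n) (x + y) * (g (x + y) : ℂ)) *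
          conj (mFourier (-n) y * (g y : ℂ)) ∂torusMeasure d ∂torusMeasure d := by
        refine integral_congr_ae (.of_forall fun x => ?_)
        simp only [← key]
        rw [integral_const_mul, integral_complex_ofReal]
    _ = ∫ y, ∫ x, (mFourier (-n) (x + y) * (g (x + y) : ℂ)) *
          conj (mFourier (-n) y * (g y : ℂ)) ∂torusMeasure d ∂torusMeasure d :=
        integral_integral_swap hint
    _ = ∫ y, (∫ x, mFourier (-n) x * (g x : ℂ) ∂torusMeasure d) *
          conj (mFourier (-n) y * (g y : ℂ)) ∂torusMeasure d := by
        refine integral_congr_ae (.of_forall fun y => ?_)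
        simp only
        rw [integral_mul_const,
          integral_add_right_eq_self (fun x => mFourier (-n) x * (g x : ℂ)) y]
    _ = _ := by
        rw [integral_const_mul, integral_conj, Complex.mul_conj, Complex.normSq_eq_norm_sq]

/-- Positive definite continuous functions with value `1` at the origin and arbitrarily small
support. -/
theorem exists_posDef_bump (d : ℕ) {ε : ℝ} (hε : 0 < ε) :
    ∃ h : UnitAddTorus (Fin d) → ℝ, Continuous h ∧ h 0 = 1 ∧ (∀ x, ε ≤ ‖x‖ → h x = 0) ∧
      ∀ n, ∃ r : ℝ, 0 ≤ r ∧ mFourierCoeff (fun x => (h x : ℂ)) n = r := by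
  -- A tent of radius `ε / 2`: its autocorrelation vanishes at distance `≥ ε` from the origin and
  -- has coefficients `‖ĝ n‖ ^ 2`. Dividing by the value `c` at the origin normalizes it.
  let g : UnitAddTorus (Fin d) → ℝ := fun x => max 0 (ε / 2 - ‖x‖)
  have hg : Continuous g := by fun_prop
  have hg0 {x} (hx : ε / 2 ≤ ‖x‖) : g x = 0 := max_eq_left (by linarith)
  let c : ℝ := ∫ y, g y * g y ∂torusMeasure d
  have hc : 0 < c := by
    refine Continuous.integral_pos_of_hasCompactSupport_nonneg_nonzero (x := 0) (by fun_prop)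
      (HasCompactSupport.of_compactSpace _) (fun x => mul_self_nonneg _) ?_
    have : g 0 = ε / 2 := by simp [g, half_pos hε |>.le]
    simp only [this]
    positivity
  refine ⟨fun x => (∫ y, g (x + y) * g y ∂torusMeasure d) / c, ?_, ?_, fun x hx => ?_,
    fun n => ⟨‖mFourierCoeff (fun x => (g x : ℂ)) n‖ ^ 2 / c, by positivity, ?_⟩⟩
  · have : Continuous fun x => ∫ y in Set.univ, g (x + y) * g y ∂torusMeasure d :=
      continuous_parametric_integral_of_continuous (by unfold Function.uncurry; fun_prop)
        isCompact_univ
    simp only [Measure.restrict_univ] at this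
    fun_prop
  · simp only [zero_add]
    exact div_self hc.ne'
  · have : ∀ y, g (x + y) * g y = 0 := by
      intro y
      by_cases hy : ε / 2 ≤ ‖y‖
      · rw [hg0 hy, mul_zero]
      · have h2 : ‖x‖ ≤ ‖x + y‖ + ‖y‖ := by simpa using norm_sub_le (x + y) y
        rw [hg0 (x := x + y) (by linarith), zero_mul]
    simp [this]
  · have h := mFourierCoeff_autocorrelation hg n
    simp only [mFourierCoeff_eq_integral_torusMeasure] at h ⊢
    rw [Complex.ofReal_div, ← h, ← integral_div]
    refine integral_congr_ae (.of_forall fun x => ?_)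
    simp only [Complex.ofReal_div, mul_div_assoc]

theorem mFourierCoeff_add_right (h : UnitAddTorus (Fin d) → ℂ) (p : UnitAddTorus (Fin d))
    (n : Fin d → ℤ) :
    mFourierCoeff (fun x => h (x + p)) n = mFourier n p * mFourierCoeff h n := by
  simp only [mFourierCoeff_eq_integral_torusMeasure]
  rw [← integral_add_right_eq_self (fun x => mFourier (-n) x * h x) p, ← integral_const_mul]
  refine integral_congr_ae (.of_forall fun x => ?_)
  have h1 : mFourier n p * mFourier (-n) p = 1 := by
    rw [← mFourier_add, add_neg_cancel, mFourier_zero, ContinuousMap.one_apply]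
  simp only [mFourier_apply_add]
  linear_combination (-mFourier (-n) x * h (x + p)) * h1

end UnitAddTorus

open UnitAddTorus

variable {d : ℕ}

/-- A bump of radius `ε` centred at `p` stays in `Ω` and does not contribute at `z` unless `p = z`.
The eventual form lets finitely many centres share one `ε`. -/
theorem exists_small_radius {Ω : Set (UnitAddTorus (Fin d))} (hΩ : IsOpen Ω)
    {p : UnitAddTorus (Fin d)} (hp : p ∈ Ω) (z : UnitAddTorus (Fin d)) :
    ∀ᶠ ε in nhdsWithin (0 : ℝ) (Set.Ioi 0), Metric.closedBall p ε ⊆ Ω ∧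
      (p ≠ z → ε ≤ ‖z - p‖) := by
  obtain ⟨δ, hδ, hb⟩ := Metric.isOpen_iff.mp hΩ p hp
  have h1 : ∀ᶠ ε in nhdsWithin (0 : ℝ) (Set.Ioi 0), ε < δ :=
    (gt_mem_nhds hδ).filter_mono nhdsWithin_le_nhds
  have h2 : ∀ᶠ ε in nhdsWithin (0 : ℝ) (Set.Ioi 0), p ≠ z → ε ≤ ‖z - p‖ := by
    by_cases hpz : p = z
    · simp [hpz]
    · have : 0 < ‖z - p‖ := norm_pos_iff.mpr (sub_ne_zero.mpr (Ne.symm hpz))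
      filter_upwards [(gt_mem_nhds this).filter_mono nhdsWithin_le_nhds] with ε hε _ using hε.le
  filter_upwards [h1, h2] with ε e1 e2
  exact ⟨(Metric.closedBall_subset_ball e1).trans hb, e2⟩

/-- A trigonometric polynomial which is nonnegative at the angles of all characters at `z` gives
an admissible function, the convolution of a discrete measure on the orbit of `z` with a
positive definite bump. -/
theorem exists_isTorusAdmissible {Ω : Set (UnitAddTorus (Fin d))} (hΩ : IsOpen Ω)
    (h0 : (0 : UnitAddTorus (Fin d)) ∈ Ω) (z : UnitAddTorus (Fin d)) (K : Finset ℕ) (C : ℕ → ℝ)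
    (hKΩ : ∀ k ∈ K, k • z ∈ Ω ∧ -(k • z) ∈ Ω) (hK0 : ∀ k ∈ K, k • z ≠ 0)
    (hKz : ∀ k ∈ K, k ≠ 1 → k • z ≠ z ∧ -(k • z) ≠ z)
    (hpos : ∀ n : Fin d → ℤ, 0 ≤ 1 + ∑ k ∈ K, C k * (fourier (k : ℤ) (angle n z)).re) :
    ∃ f, IsTorusAdmissible Ω f ∧
      (1 ∈ K → f z = C 1 / 2 * (1 + if -z = z then 1 else 0)) := by
  classical
  let P : Finset (UnitAddTorus (Fin d)) :=
    insert 0 (K.image (fun k => k • z) ∪ K.image fun k => -(k • z))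
  have hPΩ : ∀ p ∈ P, p ∈ Ω := by
    intro p hp
    simp only [P, Finset.mem_insert, Finset.mem_union, Finset.mem_image] at hp
    rcases hp with rfl | ⟨k, hk, rfl⟩ | ⟨k, hk, rfl⟩
    exacts [h0, (hKΩ k hk).1, (hKΩ k hk).2]
  have hε : ∀ᶠ ε in nhdsWithin (0 : ℝ) (Set.Ioi 0), 0 < ε ∧ ∀ p ∈ P,
      (Metric.closedBall p ε ⊆ Ω ∧ (p ≠ z → ε ≤ ‖z - p‖)) ∧
      (Metric.closedBall p ε ⊆ Ω ∧ (p ≠ 0 → ε ≤ ‖0 - p‖)) := by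
    refine (eventually_nhdsWithin_of_forall fun _ h => h).and ?_
    rw [Filter.eventually_all_finset]
    exact fun p hp => (exists_small_radius hΩ (hPΩ p hp) z).and
      (exists_small_radius hΩ (hPΩ p hp) 0)
  obtain ⟨ε, hε0, hε⟩ := hε.exists
  obtain ⟨h, hcont, hone, hsupp, hcoeff⟩ := exists_posDef_bump d hε0
  have hP0 : (0 : UnitAddTorus (Fin d)) ∈ P := by simp [P]
  have hPk {k} (hk : k ∈ K) : k • z ∈ P ∧ -(k • z) ∈ P := by
    simp only [P, Finset.mem_insert, Finset.mem_union, Finset.mem_image]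
    exact ⟨Or.inr (Or.inl ⟨k, hk, rfl⟩), Or.inr (Or.inr ⟨k, hk, rfl⟩)⟩
  have hzero {p q} (hp : p ∈ P) (hpq : p ≠ q) (hq : q = 0 ∨ q = z) : h (q - p) = 0 := by
    apply hsupp
    rcases hq with rfl | rfl
    · exact (hε p hp).2.2 hpq
    · exact (hε p hp).1.2 hpq
  have hzero' {k} (hk : k ∈ K) {q} (hpq : -(k • z) ≠ q) (hq : q = 0 ∨ q = z) :
      h (q + k • z) = 0 := by
    simpa using hzero (hPk hk).2 hpq hq
  let f : UnitAddTorus (Fin d) → ℝ := fun x =>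
    h x + ∑ k ∈ K, C k / 2 * (h (x - k • z) + h (x + k • z))
  have hfcont : Continuous f := by fun_prop
  -- Translation by `± k • z` multiplies a coefficient by conjugate values of the character, which
  -- pair up to a cosine of the angle.
  have hcoeff_f (n : Fin d → ℤ) : mFourierCoeff (fun x => (f x : ℂ)) n =
      ((1 + ∑ k ∈ K, C k * (fourier (k : ℤ) (angle n z)).re : ℝ) : ℂ) *
        mFourierCoeff (fun x => (h x : ℂ)) n := by
    have hi (p : UnitAddTorus (Fin d)) :
        Integrable (fun x => mFourier (-n) x * (h (x + p) : ℂ)) (torusMeasure d) :=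
      integrable_torusMeasure (by fun_prop)
    have hsplit (x : UnitAddTorus (Fin d)) : mFourier (-n) x * (f x : ℂ) =
        mFourier (-n) x * (h (x + 0) : ℂ) + ∑ k ∈ K, (C k / 2 : ℂ) *
          (mFourier (-n) x * (h (x + -(k • z)) : ℂ) + mFourier (-n) x * (h (x + k • z) : ℂ)) := by
      simp only [f, add_zero, sub_eq_add_neg]
      push_cast
      rw [mul_add, Finset.mul_sum]
      congr 1
      refine Finset.sum_congr rfl fun k _ => ?_
      ring
    have hshift (p : UnitAddTorus (Fin d)) :
        ∫ x, mFourier (-n) x * (h (x + p) : ℂ) ∂torusMeasure d =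
          mFourier n p * mFourierCoeff (fun x => (h x : ℂ)) n :=
      mFourierCoeff_add_right (fun x => (h x : ℂ)) p n
    have hik (k : ℕ) : Integrable (fun x => (C k / 2 : ℂ) *
        (mFourier (-n) x * (h (x + -(k • z)) : ℂ) + mFourier (-n) x * (h (x + k • z) : ℂ)))
        (torusMeasure d) :=
      ((hi _).add (hi _)).const_mul _
    rw [mFourierCoeff_eq_integral_torusMeasure]
    simp_rw [hsplit]
    rw [integral_add (hi 0) (integrable_finsetSum K fun k _ => hik k),
      integral_finsetSum K fun k _ => hik k, hshift, mFourier_apply_zero]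
    simp_rw [integral_const_mul, fun k : ℕ => integral_add (hi (-(k • z))) (hi (k • z)), hshift]
    push_cast
    rw [add_mul, Finset.sum_mul]
    congr 1
    refine Finset.sum_congr rfl fun k _ => ?_
    have : mFourier n (k • z) = fourier (k : ℤ) (angle n z) := by
      rw [← mFourier_zsmul, natCast_zsmul]
    rw [mFourier_apply_neg, this, Complex.re_eq_add_conj]
    ring
  refine ⟨f, ⟨hfcont, ?_, ?_, fun n => ?_, fun n => ?_⟩, fun h1K => ?_⟩
  · have hclosed : IsClosed (⋃ p ∈ P, Metric.closedBall p ε) :=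
      P.finite_toSet.isClosed_biUnion fun p _ => Metric.isClosed_closedBall
    refine (closure_minimal ?_ hclosed).trans (Set.iUnion₂_subset fun p hp => (hε p hp).1.1)
    intro x hx
    by_contra hx'
    have hx0 {p} (hp : p ∈ P) : h (x - p) = 0 := by
      apply hsupp
      by_contra hlt
      refine hx' (Set.mem_biUnion hp ?_)
      rw [Metric.mem_closedBall, dist_eq_norm]
      exact (not_le.mp hlt).le
    refine hx ?_
    have a0 : h x = 0 := by simpa using hx0 hP0
    simp only [f, a0, zero_add]
    refine Finset.sum_eq_zero fun k hk => ?_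
    have a2 : h (x + k • z) = 0 := by simpa using hx0 (hPk hk).2
    rw [hx0 (hPk hk).1, a2]
    simp
  · simp only [f, hone]
    rw [Finset.sum_eq_zero, add_zero]
    intro k hk
    rw [hzero (hPk hk).1 (hK0 k hk) (Or.inl rfl),
      hzero' hk (neg_ne_zero.mpr (hK0 k hk)) (Or.inl rfl)]
    simp
  · obtain ⟨r, hr, hrn⟩ := hcoeff n
    rw [hcoeff_f, hrn, ← Complex.ofReal_mul, Complex.ofReal_re]
    exact mul_nonneg (hpos n) hr
  · obtain ⟨r, hr, hrn⟩ := hcoeff n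
    rw [hcoeff_f, hrn, ← Complex.ofReal_mul, Complex.ofReal_im]
  · have hz0 : z ≠ 0 := by simpa using hK0 1 h1K
    have a0 : h z = 0 := by simpa using hzero hP0 hz0.symm (Or.inr rfl)
    simp only [f, a0, zero_add]
    rw [Finset.sum_eq_single_of_mem 1 h1K]
    -- If `-z = z`, the bumps at `z` and `-z` coincide and the value doubles.
    · have a2 : h (z + z) = if -z = z then 1 else 0 := by
        split_ifs with hneg
        · have : z + z = 0 := by nth_rw 1 [← hneg]; exact neg_add_cancel z
          rw [this, hone]
        · simpa using hzero' h1K (q := z) (by simpa using hneg) (Or.inr rfl)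
      simp only [one_smul, sub_self, hone, a2]
    · intro k hk hk1
      rw [hzero (hPk hk).1 (hKz k hk hk1).1 (Or.inr rfl),
        hzero' hk (hKz k hk hk1).2 (Or.inr rfl)]
      simp

end

/-! ### Fejér sums and cosine polynomials -/

section

open UnitAddTorus

section Fejer

theorem sum_sum_fourier_sub_re_nonneg (N : ℕ) (p : UnitAddCircle) :
    0 ≤ ∑ j ∈ Finset.range N, ∑ l ∈ Finset.range N, (fourier ((j : ℤ) - l) p).re := by
  have h := sum_mul_conj_eq_norm_sq (Finset.range N) fun j : ℕ => fourier (j : ℤ) p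
  simp_rw [← fourier_neg, ← fourier_add, ← sub_eq_add_neg] at h
  have h' := congrArg Complex.re h
  simp only [Complex.re_sum, Complex.ofReal_re] at h'
  rw [h']
  positivity

/-- The product of two cosines is the mean of cosines at `p + q` and `p - q`, which reduces to
squares of absolute values of exponential sums. -/
theorem sum_sum_fourier_sub_re_mul_re_nonneg (N : ℕ) (p q : UnitAddCircle) :
    0 ≤ ∑ j ∈ Finset.range N, ∑ l ∈ Finset.range N,
      (fourier ((j : ℤ) - l) p).re * (fourier ((j : ℤ) - l) q).re := by
  have key (k : ℤ) : (fourier k p).re * (fourier k q).re =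
      1 / 2 * (fourier k (p + q)).re + 1 / 2 * (fourier k (p - q)).re := by
    have h1 : fourier k (p + q) = fourier k p * fourier k q := by
      simp [fourier_apply, AddCircle.toCircle_add]
    have h2 : fourier k (p - q) = fourier k p * conj (fourier k q) := by
      rw [← fourier_neg']
      simp [fourier_apply, sub_eq_add_neg, AddCircle.toCircle_add]
    rw [h1, h2, Complex.mul_re, Complex.mul_re, Complex.conj_re, Complex.conj_im]
    ring
  simp_rw [key, Finset.sum_add_distrib, ← Finset.mul_sum]
  have := sum_sum_fourier_sub_re_nonneg N (p + q)
  have := sum_sum_fourier_sub_re_nonneg N (p - q)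
  positivity

/-- The difference `k` occurs `N - |k|` times; these multiplicities become the Fejér weights. -/
theorem sum_sum_sub_of_even {g : ℤ → ℝ} (hg : ∀ k, g (-k) = g k) (N : ℕ) :
    ∑ j ∈ Finset.range N, ∑ l ∈ Finset.range N, g ((j : ℤ) - l) =
      N * g 0 + 2 * ∑ k ∈ Finset.Ico 1 N, ((N : ℝ) - k) * g k := by
  -- Including `k = 0` in the sum makes the induction on `N` uniform.
  have hT (N : ℕ) : N * g 0 + 2 * ∑ k ∈ Finset.Ico 1 N, ((N : ℝ) - k) * g k =
      2 * ∑ k ∈ Finset.range N, ((N : ℝ) - k) * g k - N * g 0 := by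
    cases N with
    | zero => simp
    | succ N =>
      rw [Finset.range_eq_Ico, Finset.sum_eq_sum_Ico_succ_bot (Nat.succ_pos N)]
      push_cast
      ring
  rw [hT]
  induction N with
  | zero => simp
  | succ N ih =>
    have h1 : ∑ j ∈ Finset.range N, g ((j : ℤ) - N) = ∑ k ∈ Finset.range N, g (k + 1 : ℤ) := by
      rw [← Finset.sum_range_reflect]
      refine Finset.sum_congr rfl fun k hk => ?_
      have := Finset.mem_range.mp hk
      rw [← hg]
      congr 1
      omega
    have h2 : ∑ l ∈ Finset.range N, g ((N : ℤ) - l) = ∑ k ∈ Finset.range N, g (k + 1 : ℤ) := by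
      rw [← h1]
      refine Finset.sum_congr rfl fun k _ => ?_
      rw [← hg]
      congr 1
      ring
    have h3 : ∑ k ∈ Finset.range (N + 1), (((N + 1 : ℕ) : ℝ) - k) * g k =
        ∑ k ∈ Finset.range N, ((N : ℝ) - k) * g k + ∑ k ∈ Finset.range (N + 1), g k := by
      rw [Finset.sum_range_succ, Finset.sum_range_succ (fun k : ℕ => g k), ← add_assoc,
        ← Finset.sum_add_distrib]
      congr 1
      · refine Finset.sum_congr rfl fun k _ => ?_
        push_cast
        ring
      · push_cast
        ring
    have h4 := Finset.sum_range_succ' (fun k : ℕ => g k) N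
    rw [h3, h4, Finset.sum_range_succ, Finset.sum_range_succ (fun l : ℕ => g ((N : ℤ) - l)), h2]
    simp_rw [Finset.sum_range_succ (fun l : ℕ => g (_ - (l : ℤ)))]
    rw [Finset.sum_add_distrib, h1, ih]
    push_cast
    simp only [sub_self]
    ring

/-- Fejér means of an even positive definite sequence are nonnegative. -/
theorem fejer_mean_nonneg {a : ℤ → ℝ} (ha : ∀ k, a (-k) = a k) (ha0 : a 0 = 1) {N : ℕ}
    (hN : 0 < N) (t : UnitAddCircle)
    (hpos : 0 ≤ ∑ j ∈ Finset.range N, ∑ l ∈ Finset.range N,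
      a ((j : ℤ) - l) * (fourier ((j : ℤ) - l) t).re) :
    0 ≤ 1 + ∑ k ∈ Finset.Ico 1 N, 2 * (1 - (k : ℝ) / N) * a k * (fourier (k : ℤ) t).re := by
  rw [sum_sum_sub_of_even (g := fun k => a k * (fourier k t).re)
    (fun k => by simp only [ha, fourier_neg, Complex.conj_re])] at hpos
  have hN' : (0 : ℝ) < N := by exact_mod_cast hN
  refine le_of_mul_le_mul_left (a := (N : ℝ)) ?_ hN'
  rw [mul_zero]
  refine hpos.trans_eq ?_
  rw [mul_add, Finset.mul_sum, Finset.mul_sum]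
  simp only [ha0, fourier_zero, Complex.one_re, mul_one]
  congr 1
  refine Finset.sum_congr rfl fun k _ => ?_
  field_simp

/-- For fixed `l` the differences run through all residues mod `m`, so all weights are equal and
nothing is lost to Fejér damping. -/
theorem sum_sum_sub_of_periodic {g : ℤ → ℝ} {m : ℕ} (hg : ∀ k, g (k + m) = g k) :
    ∑ j ∈ Finset.range m, ∑ l ∈ Finset.range m, g ((j : ℤ) - l) =
      m * ∑ k ∈ Finset.range m, g k := by
  have h (l : ℕ) : ∑ j ∈ Finset.range m, g ((j : ℤ) - l) = ∑ k ∈ Finset.range m, g k := by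
    induction l with
    | zero => simp
    | succ l ih =>
      rw [← ih]
      have h1 := Finset.sum_range_succ (fun j : ℕ => g ((j : ℤ) - (l + 1 : ℕ))) m
      rw [Finset.sum_range_succ'] at h1
      have h2 : g ((m : ℤ) - (l + 1 : ℕ)) = g (((0 : ℕ) : ℤ) - (l + 1 : ℕ)) := by
        rw [← hg (((0 : ℕ) : ℤ) - (l + 1 : ℕ))]
        congr 1
      rw [h2] at h1
      rw [← add_right_cancel h1]
      refine Finset.sum_congr rfl fun j _ => ?_
      push_cast
      ring_nf
  rw [Finset.sum_comm, Finset.sum_congr rfl fun l _ => h l]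
  simp

/-- Fold along `k ↔ m - k`; the fixed point `k = m / 2`, present for even `m`, counts once. -/
theorem sum_range_of_even_of_periodic {g : ℤ → ℝ} {m : ℕ} (hm : 0 < m)
    (heven : ∀ k, g (-k) = g k) (hper : ∀ k, g (k + m) = g k) :
    ∑ k ∈ Finset.range m, g k =
      g 0 + ∑ k ∈ Finset.Icc 1 (m / 2), (if 2 * k = m then 1 else 2) * g k := by
  rw [Finset.range_eq_Ico, Finset.sum_eq_sum_Ico_succ_bot hm, zero_add, Nat.cast_zero,
    ← Finset.sum_Ico_consecutive _ (show 1 ≤ m / 2 + 1 by omega) (show m / 2 + 1 ≤ m by omega)]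
  have h : ∑ k ∈ Finset.Ico (m / 2 + 1) m, g k =
      ∑ k ∈ Finset.Icc 1 (m / 2) with 2 * k ≠ m, g k := by
    refine Finset.sum_nbij' (fun k => m - k) (fun k => m - k) ?_ ?_ ?_ ?_ ?_
    · intro k hk
      simp only [Finset.mem_Ico, Finset.mem_filter, Finset.mem_Icc] at hk ⊢
      omega
    · intro k hk
      simp only [Finset.mem_Ico, Finset.mem_filter, Finset.mem_Icc] at hk ⊢
      omega
    · intro k hk
      simp only [Finset.mem_Ico] at hk
      omega
    · intro k hk
      simp only [Finset.mem_filter, Finset.mem_Icc] at hk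
      omega
    · intro k hk
      simp only [Finset.mem_Ico] at hk
      rw [← heven, ← hper]
      congr 1
      omega
  rw [h, Finset.sum_filter, Finset.Ico_add_one_right_eq_Icc, ← Finset.sum_add_distrib]
  congr 1
  refine Finset.sum_congr rfl fun k _ => ?_
  by_cases hk : 2 * k = m
  · simp [hk]
  · rw [if_pos hk, if_neg hk]
    ring

end Fejer

theorem fourierCoeff_cosinePolynomial (N : ℕ) (C : ℕ → ℝ) (n : ℤ) :
    fourierCoeff (fun t : UnitAddCircle =>
      ((1 + ∑ k ∈ Finset.Ico 1 N, C k * (fourier (k : ℤ) t).re : ℝ) : ℂ)) n =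
      if n = 0 then 1 else if n.natAbs < N then ((C n.natAbs / 2 : ℝ) : ℂ) else 0 := by
  let F (k : ℤ) : UnitAddCircle → ℂ := fourier k
  have hF (k : ℤ) : fourierCoeff (F k) = Pi.single k 1 := fourierCoeff_fourier k
  have hi (k : ℤ) : Integrable (F k) AddCircle.haarAddCircle :=
    (map_continuous _).integrable_of_hasCompactSupport (HasCompactSupport.of_compactSpace _)
  have hsplit : (fun t : UnitAddCircle =>
      ((1 + ∑ k ∈ Finset.Ico 1 N, C k * (fourier (k : ℤ) t).re : ℝ) : ℂ)) =
      F 0 + ∑ k ∈ Finset.Ico 1 N, ((C k / 2 : ℝ) : ℂ) • (F k + F (-(k : ℤ))) := by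
    ext t
    simp only [F, Pi.add_apply, Finset.sum_apply, Pi.smul_apply, smul_eq_mul, fourier_zero]
    push_cast
    congr 1
    refine Finset.sum_congr rfl fun k _ => ?_
    rw [fourier_neg, Complex.re_eq_add_conj]
    ring
  have hik (k : ℕ) : Integrable (((C k / 2 : ℝ) : ℂ) • (F k + F (-(k : ℤ))))
      AddCircle.haarAddCircle := ((hi _).add (hi _)).smul _
  rw [hsplit, fourierCoeff.add (hi 0) (integrable_finsetSum' _ fun k _ => hik k),
    fourierCoeff.sum _ _ fun k _ => hik k]
  simp only [Pi.add_apply, Finset.sum_apply, fourierCoeff.const_smul,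
    fourierCoeff.add (hi _) (hi _), hF, Pi.single_apply, smul_eq_mul]
  have hterm (k : ℕ) (hk : k ∈ Finset.Ico 1 N) :
      ((C k / 2 : ℝ) : ℂ) * ((if n = k then 1 else 0) + if n = -(k : ℤ) then 1 else 0) =
        if n.natAbs = k then ((C k / 2 : ℝ) : ℂ) else 0 := by
    have := (Finset.mem_Ico.mp hk).1
    by_cases h1 : n = k
    · rw [if_pos h1, if_neg (by omega), if_pos (by omega)]
      ring
    · by_cases h2 : n = -(k : ℤ)
      · rw [if_neg h1, if_pos h2, if_pos (by omega)]
        ring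
      · rw [if_neg h1, if_neg h2, if_neg (by omega)]
        ring
  rw [Finset.sum_congr rfl hterm, Finset.sum_ite_eq]
  by_cases hn : n = 0
  · simp [hn]
  · have : n.natAbs ∈ Finset.Ico 1 N ↔ n.natAbs < N := by
      rw [Finset.mem_Ico]
      omega
    simp only [this, if_neg hn, zero_add]

end

/-! ### Passage between the torus and the circle; degenerate and infinite orbits -/

section

open UnitAddTorus

variable {d : ℕ}

namespace IsTorusAdmissible

variable {Ω : Set (UnitAddTorus (Fin d))} {f : UnitAddTorus (Fin d) → ℝ}

/-- Expanding `f` in characters gives a nonnegative combination of the cosine double sums at the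
angles of `z`. -/
theorem sum_sum_zsmul_mul_re_nonneg (hf : IsTorusAdmissible Ω f) (z : UnitAddTorus (Fin d))
    (N : ℕ) (t : UnitAddCircle) :
    0 ≤ ∑ j ∈ Finset.range N, ∑ l ∈ Finset.range N,
      f (((j : ℤ) - l) • z) * (fourier ((j : ℤ) - l) t).re := by
  have h := hasSum_sum (s := Finset.range N) fun (j : ℕ) _ =>
    hasSum_sum (s := Finset.range N) fun (l : ℕ) _ =>
      (hf.hasSum_coeff_mul_re (((j : ℤ) - l) • z)).mul_right (fourier ((j : ℤ) - l) t).re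
  refine h.nonneg fun n => ?_
  simp_rw [mul_assoc, ← Finset.mul_sum, mFourier_zsmul]
  exact mul_nonneg (hf.coeff_re_nonneg n) (sum_sum_fourier_sub_re_mul_re_nonneg N _ _)

end IsTorusAdmissible

namespace MemPhi

variable {H : Set ℕ} {φ : UnitAddCircle → ℝ} {lam : ℝ} {c : ℕ → ℝ}

theorem integrable_haar (hφ : MemPhi H φ lam c) : Integrable φ AddCircle.haarAddCircle := by
  have := hφ.integrable
  rwa [AddCircle.volume_eq_smul_haarAddCircle, ENNReal.ofReal_one, one_smul] at this

theorem fourierCoeff_re (hφ : MemPhi H φ lam c) (n : ℤ) :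
    (fourierCoeff (fun t => (φ t : ℂ)) n).re =
      ∫ s, φ s * (fourier n s).re ∂AddCircle.haarAddCircle := by
  have hi : Integrable (fun s => fourier (-n) s • (φ s : ℂ)) AddCircle.haarAddCircle :=
    hφ.integrable_haar.ofReal.fourier_smul (-n)
  rw [fourierCoeff, ← Complex.reCLM_apply, ← Complex.reCLM.integral_comp_comm hi]
  refine integral_congr_ae (.of_forall fun s => ?_)
  simp only [smul_eq_mul, Complex.reCLM_apply, Complex.re_mul_ofReal, fourier_neg,
    Complex.conj_re]
  ring

theorem integrable_mul_re (hφ : MemPhi H φ lam c) (n : ℤ) :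
    Integrable (fun s => φ s * (fourier n s).re) AddCircle.haarAddCircle := by
  have hi : Integrable (fun s => fourier n s • (φ s : ℂ)) AddCircle.haarAddCircle :=
    hφ.integrable_haar.ofReal.fourier_smul n
  refine hi.re.congr (.of_forall fun s => ?_)
  simp [mul_comm, -fourier_apply]

/-- The same cosine double sums, integrated against `φ ≥ 0`. -/
theorem sum_sum_fourierCoeff_mul_re_nonneg (hφ : MemPhi H φ lam c) (N : ℕ) (t : UnitAddCircle) :
    0 ≤ ∑ j ∈ Finset.range N, ∑ l ∈ Finset.range N,
      (fourierCoeff (fun t => (φ t : ℂ)) ((j : ℤ) - l)).re * (fourier ((j : ℤ) - l) t).re := by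
  simp_rw [hφ.fourierCoeff_re, ← integral_mul_const]
  have hi (j l : ℕ) := (hφ.integrable_mul_re ((j : ℤ) - l)).mul_const (fourier ((j : ℤ) - l) t).re
  rw [← Finset.sum_congr rfl fun j _ => integral_finsetSum _ fun l _ => hi j l,
    ← integral_finsetSum _ fun j _ => integrable_finsetSum _ fun l _ => hi j l]
  refine integral_nonneg fun s => ?_
  simp only [mul_assoc, ← Finset.mul_sum]
  exact mul_nonneg (hφ.nonneg s) (sum_sum_fourier_sub_re_mul_re_nonneg N s t)

end MemPhi

/-- The common frame for infinite and finite orbits; infinite values of the supremum are dealt with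
here. -/
theorem torusExtremal_eq_half_mul_sSup {Ω : Set (UnitAddTorus (Fin d))}
    {z : UnitAddTorus (Fin d)} {S : Set EReal}
    (hle : ∀ f, IsTorusAdmissible Ω f → ((2 * f z : ℝ) : EReal) ≤ sSup S)
    (hge : ∀ x ∈ S, ∃ lam : ℝ, x = lam ∧ ((lam / 2 : ℝ) : EReal) ≤ torusExtremal Ω z) :
    torusExtremal Ω z = ((1 / 2 : ℝ) : EReal) * sSup S := by
  refine le_antisymm (iSup₂_le fun f hf => ?_) ?_
  · have h := hle f hf
    generalize sSup S = E at h ⊢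
    induction E with
    | bot => exact absurd h (not_le.mpr (EReal.bot_lt_coe _))
    | top => rw [EReal.coe_mul_top_of_pos (by norm_num)]; exact le_top
    | coe r =>
      rw [← EReal.coe_mul]
      have := EReal.coe_le_coe_iff.mp h
      exact EReal.coe_le_coe_iff.mpr (by linarith)
  · have key (y : ℝ) (hy : torusExtremal Ω z ≤ y) : ((1 / 2 : ℝ) : EReal) * sSup S ≤ y := by
      have : sSup S ≤ ((2 * y : ℝ) : EReal) := by
        refine sSup_le fun x hx => ?_
        obtain ⟨lam, rfl, h⟩ := hge x hx
        have := EReal.coe_le_coe_iff.mp (h.trans hy)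
        exact EReal.coe_le_coe_iff.mpr (by linarith)
      generalize sSup S = E at this ⊢
      induction E with
      | bot => rw [EReal.coe_mul_bot_of_pos (by norm_num)]; exact bot_le
      | top => exact absurd this (not_le.mpr (EReal.coe_lt_top _))
      | coe r =>
        rw [← EReal.coe_mul]
        have := EReal.coe_le_coe_iff.mp this
        exact EReal.coe_le_coe_iff.mpr (by linarith)
    exact EReal.le_of_forall_lt_iff_le.mp fun y hy => key y hy.le

/-- Removes the Fejér weight `1 - 1/N` of the frequency `1` by letting `N → ∞`. -/
theorem EReal.coe_le_of_forall_one_sub_inv_mul_le {a : ℝ} {E : EReal}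
    (h : ∀ N : ℕ, 2 ≤ N → (((1 - 1 / (N : ℝ)) * a : ℝ) : EReal) ≤ E) : (a : EReal) ≤ E := by
  have hlim : Filter.Tendsto (fun N : ℕ => (((1 - 1 / (N : ℝ)) * a : ℝ) : EReal))
      Filter.atTop (nhds a) := by
    refine EReal.tendsto_coe.mpr ?_
    simpa using (tendsto_one_div_atTop_nhds_zero_nat (𝕜 := ℝ)).const_sub 1 |>.mul_const a
  exact le_of_tendsto hlim (Filter.eventually_atTop.mpr ⟨2, h⟩)

theorem le_torusExtremal {Ω : Set (UnitAddTorus (Fin d))} {f : UnitAddTorus (Fin d) → ℝ}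
    (hf : IsTorusAdmissible Ω f) (z : UnitAddTorus (Fin d)) :
    (f z : EReal) ≤ torusExtremal Ω z :=
  le_iSup₂ (f := fun f (_ : IsTorusAdmissible Ω f) => (f z : EReal)) f hf

theorem torusExtremal_neg (Ω : Set (UnitAddTorus (Fin d))) (z : UnitAddTorus (Fin d)) :
    torusExtremal Ω (-z) = torusExtremal Ω z :=
  iSup_congr fun f => iSup_congr fun hf => by rw [hf.map_neg]

theorem torusOrbit_eq_zmultiples (z : UnitAddTorus (Fin d)) :
    torusOrbit z = AddSubgroup.zmultiples z := rfl

theorem zsmul_eq_zero_of_infinite_torusOrbit {z : UnitAddTorus (Fin d)}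
    (hz : (torusOrbit z).Infinite) {k : ℤ} (hk : k • z = 0) : k = 0 := by
  by_contra h
  refine hz ?_
  rw [torusOrbit_eq_zmultiples]
  exact finite_zmultiples.mpr (isOfFinAddOrder_iff_zsmul_eq_zero.mpr ⟨k, h, hk⟩)

theorem addOrderOf_eq_of_encard_torusOrbit {z : UnitAddTorus (Fin d)} {m : ℕ}
    (hz : (torusOrbit z).encard = m) : addOrderOf z = m := by
  rw [← Nat.card_zmultiples, ← SetLike.coe_sort_coe, ← torusOrbit_eq_zmultiples,
    Nat.card_coe_set_eq, Set.ncard, hz, ENat.toNat_natCast]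

theorem neg_eq_self_of_encard_torusOrbit_le_two {z : UnitAddTorus (Fin d)}
    (hz : (torusOrbit z).encard ≤ 2) : -z = z := by
  obtain ⟨m, hm⟩ := ENat.ne_top_iff_exists.mp (hz.trans_lt (ENat.natCast_lt_top 2)).ne
  have ho := addOrderOf_eq_of_encard_torusOrbit hm.symm
  rw [← hm] at hz
  have hm2 : m ≤ 2 := by exact_mod_cast hz
  have hfin : (torusOrbit z).Finite := Set.encard_ne_top_iff.mp (by simp [← hm])
  -- `addOrderOf` is `0` for infinite order, so `m = 0` has to be excluded.
  have hpos : 0 < addOrderOf z := addOrderOf_pos_iff.mpr (finite_zmultiples.mp hfin)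
  have h2 : 2 • z = 0 := by
    rw [← addOrderOf_dvd_iff_nsmul_eq_zero, ho]
    interval_cases m
    · omega
    · exact one_dvd 2
    · exact dvd_rfl
  rw [two_nsmul] at h2
  exact neg_eq_of_add_eq_zero_left h2

/-- The extremal value for a point of order at most two. -/
theorem torusExtremal_eq_one {Ω : Set (UnitAddTorus (Fin d))} (hΩ : IsOpen Ω)
    (h0 : (0 : UnitAddTorus (Fin d)) ∈ Ω) {z : UnitAddTorus (Fin d)} (hz : z ∈ Ω ∩ -Ω)
    (h2 : -z = z) : torusExtremal Ω z = 1 := by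
  refine le_antisymm (iSup₂_le fun f hf => ?_) ?_
  · exact_mod_cast hf.le_one z
  · by_cases hz0 : z = 0
    · obtain ⟨f, hf, -⟩ := exists_isTorusAdmissible hΩ h0 z ∅ 0 (by simp) (by simp) (by simp)
        (by simp)
      refine le_trans ?_ (le_torusExtremal hf z)
      rw [hz0, hf.map_zero, EReal.coe_one]
    -- The polynomial `1 + cos`; the two coinciding bumps give the value `1/2 · 2`.
    · obtain ⟨f, hf, hfz⟩ := exists_isTorusAdmissible hΩ h0 z {1} 1 (by simpa using hz)
        (by simpa using hz0) (by simp) (fun n => by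
          have h1 := Complex.abs_re_le_norm (fourier 1 (angle n z))
          rw [fourier_apply, Circle.norm_coe, ← fourier_apply] at h1
          have := (abs_le.mp h1).1
          simp only [Finset.sum_singleton, Pi.one_apply, one_mul, Nat.cast_one]
          linarith)
      refine le_trans ?_ (le_torusExtremal hf z)
      rw [hfz (by simp), if_pos h2]
      norm_num

/-- The extremal value for a point with infinite orbit. -/
theorem torusExtremal_of_infinite {Ω : Set (UnitAddTorus (Fin d))} (hΩ : IsOpen Ω)
    (h0 : (0 : UnitAddTorus (Fin d)) ∈ Ω) {z : UnitAddTorus (Fin d)} (hz : z ∈ Ω ∩ -Ω)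
    (hinf : (torusOrbit z).Infinite) :
    torusExtremal Ω z = ((1 / 2 : ℝ) : EReal) * trigExtremal (multipleIndexSet Ω z) := by
  classical
  refine torusExtremal_eq_half_mul_sSup (fun f hf => ?_) ?_
  · refine EReal.coe_le_of_forall_one_sub_inv_mul_le fun N hN => le_sSup ?_
    let C : ℕ → ℝ := fun k => 2 * (1 - (k : ℝ) / N) * f ((k : ℤ) • z)
    let φ : UnitAddCircle → ℝ := fun t =>
      1 + ∑ k ∈ Finset.Ico 1 N, C k * (fourier (k : ℤ) t).re
    have hφ : Continuous φ := by fun_prop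
    have hφc (n : ℤ) := fourierCoeff_cosinePolynomial N C n
    refine ⟨φ, _, fun k => if 2 ≤ k ∧ k < N then C k else 0, ⟨?_, fun t => ?_, fun k hk => ?_, ?_,
      fun n hn => ?_, fun n hn => ?_⟩, rfl⟩
    · exact hφ.integrable_of_hasCompactSupport (HasCompactSupport.of_compactSpace _)
    · exact fejer_mean_nonneg (a := fun k => f (k • z))
          (fun k => by simp only [neg_smul, hf.map_neg])
        (by simpa using hf.map_zero) (by omega) t (hf.sum_sum_zsmul_mul_re_nonneg z N t)
    · split_ifs with h
      · have : f ((k : ℤ) • z) = 0 := by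
          refine hf.eq_zero_of_notMem fun h' => hk ⟨h.1, ?_⟩
          simpa using h'
        simp only [C, this, mul_zero]
      · rfl
    · exact (hφc 0).trans (if_pos rfl)
    · rw [hφc n, if_neg (by omega), if_pos (by omega), hn]
      simp only [C, Nat.cast_one, one_smul]
      congr 1
      ring
    · rw [hφc n, if_neg (by omega)]
      by_cases h : n.natAbs < N
      · rw [if_pos h, if_pos ⟨hn, h⟩]
      · rw [if_neg h, if_neg (fun h' => h h'.2)]
        simp
  · rintro x ⟨φ, lam, c, hφ, rfl⟩
    refine ⟨lam, rfl, EReal.coe_le_of_forall_one_sub_inv_mul_le fun N hN => ?_⟩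
    let a : ℤ → ℝ := fun k => (fourierCoeff (fun t => (φ t : ℂ)) k).re
    let C : ℕ → ℝ := fun k => 2 * (1 - (k : ℝ) / N) * a k
    -- The frequencies left out have zero coefficient, so the Fejér mean is unchanged. As the
    -- multiples of `z` are distinct, no mass with `k ∈ K` falls on `0`, and only `k = 1` reaches
    -- `z`.
    let K : Finset ℕ := {k ∈ Finset.Ico 1 N | k = 1 ∨ k ∈ multipleIndexSet Ω z}
    have hk1 {k} (hk : k ∈ K) : 1 ≤ k := (Finset.mem_Ico.mp (Finset.mem_filter.mp hk).1).1
    have ha1 : a 1 = lam / 2 := by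
      simp only [a]
      rw [hφ.coeff_one 1 rfl, Complex.ofReal_re]
    have hzero {k : ℤ} (hk : k • z = 0) : k = 0 := zsmul_eq_zero_of_infinite_torusOrbit hinf hk
    have hex : ∃ f, IsTorusAdmissible Ω f ∧
        (1 ∈ K → f z = C 1 / 2 * (1 + if -z = z then 1 else 0)) := by
      refine exists_isTorusAdmissible hΩ h0 z K C ?_ ?_ ?_ ?_
      · intro k hk
        rcases (Finset.mem_filter.mp hk).2 with rfl | h
        · simpa using hz
        · exact h.2
      · intro k hk h
        have := hzero (k := k) (by simpa using h)
        have := hk1 hk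
        omega
      · intro k hk hne
        refine ⟨fun h => ?_, fun h => ?_⟩
        · have := hzero (k := k - 1) (by simpa [sub_smul, sub_eq_zero] using h)
          omega
        · have := hzero (k := k + 1) (by
            rw [add_smul, one_smul, natCast_zsmul]; nth_rw 2 [← h]; exact add_neg_cancel _)
          omega
      · intro n
        have := fejer_mean_nonneg (a := a) (fun k => ?_) ?_ (show 0 < N by omega) (angle n z)
          (hφ.sum_sum_fourierCoeff_mul_re_nonneg N _)
        · refine this.trans_eq ?_
          congr 1
          rw [Finset.sum_filter]
          refine Finset.sum_congr rfl fun k hk => ?_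
          split_ifs with h
          · rfl
          · push Not at h
            have : a k = 0 := by
              simp only [a]
              rw [hφ.coeff_of_two_le k (by have := Finset.mem_Ico.mp hk; have := h.1; omega)]
              simp [hφ.support_subset k h.2]
            rw [this]
            ring
        · simp only [a, hφ.fourierCoeff_re, fourier_neg, Complex.conj_re]
        · simp only [a, hφ.coeff_zero, Complex.one_re]
    obtain ⟨f, hf, hfz⟩ := hex
    refine le_trans (le_of_eq ?_) (le_torusExtremal hf z)
    have hne : -z ≠ z := by
      intro h
      have := hzero (k := 2) (by rw [two_smul]; nth_rw 1 [← h]; exact neg_add_cancel z)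
      omega
    rw [hfz (by simp [K]; omega), if_neg hne]
    simp only [C, Nat.cast_one, ha1]
    congr 1
    ring

end

/-! ### Finite orbits and dependence on the orbit -/

section

open UnitAddTorus

variable {d : ℕ}

theorem fourier_coe_re (k : ℕ) (t : ℝ) :
    (fourier (k : ℤ) (t : UnitAddCircle)).re = Real.cos (2 * Real.pi * k * t) := by
  rw [fourier_coe_apply, ← Complex.exp_ofReal_mul_I_re]
  congr 2
  push_cast
  ring

/-- Summation over a subset of `[2, M]`. -/
theorem hasSum_subtype_of_subset_Icc {H : Set ℕ} {M : ℕ} (hH : H ⊆ Set.Icc 2 M) (F : ℕ → ℝ) :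
    HasSum (fun k : H => F k) (∑ k ∈ Finset.Icc 2 M, H.indicator F k) := by
  refine (hasSum_subtype_iff_indicator (f := F)).mpr (hasSum_sum_of_ne_finset_zero fun k hk => ?_)
  exact Set.indicator_of_notMem (fun h => hk (Finset.mem_Icc.mpr (hH h))) F

theorem fourier_re_add_order {m : ℕ} {t : UnitAddCircle} (ht : m • t = 0) (k : ℤ) :
    (fourier (k + m) t).re = (fourier k t).re := by
  simp only [fourier_apply, add_smul, natCast_zsmul, ht, add_zero]

theorem truncatedMultipleIndexSet_subset (m : ℕ) (Ω : Set (UnitAddTorus (Fin d)))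
    (z : UnitAddTorus (Fin d)) : truncatedMultipleIndexSet m Ω z ⊆ Set.Icc 2 (m / 2) := by
  rintro k ⟨hk, hkm⟩
  refine ⟨hk.1, (Nat.le_div_iff_mul_le two_pos).mpr ?_⟩
  have : (k : ℝ) * 2 ≤ m := by linarith
  exact_mod_cast this

theorem mem_truncatedMultipleIndexSet {m : ℕ} {Ω : Set (UnitAddTorus (Fin d))}
    {z : UnitAddTorus (Fin d)} {k : ℕ} (h2 : 2 ≤ k) (hkm : k ≤ m / 2) (h1 : k • z ∈ Ω)
    (h1' : -(k • z) ∈ Ω) : k ∈ truncatedMultipleIndexSet m Ω z := by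
  refine ⟨⟨h2, h1, h1'⟩, ?_⟩
  have : (k : ℝ) * 2 ≤ m := by exact_mod_cast (Nat.le_div_iff_mul_le two_pos).mp hkm
  linarith

/-- The extremal value for a point of finite order at least three. -/
theorem torusExtremal_of_addOrderOf {Ω : Set (UnitAddTorus (Fin d))} (hΩ : IsOpen Ω)
    (h0 : (0 : UnitAddTorus (Fin d)) ∈ Ω) {z : UnitAddTorus (Fin d)} (hz : z ∈ Ω ∩ -Ω)
    {m : ℕ} (hm : 3 ≤ m) (ho : addOrderOf z = m) :
    torusExtremal Ω z =
      ((1 / 2 : ℝ) : EReal) * trigExtremalDiscrete m (truncatedMultipleIndexSet m Ω z) := by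
  classical
  set H := truncatedMultipleIndexSet m Ω z
  have hHsub : H ⊆ Set.Icc 2 (m / 2) := truncatedMultipleIndexSet_subset m Ω z
  have hmz : m • z = 0 := by rw [← ho]; exact addOrderOf_nsmul_eq_zero z
  have hIcc : Finset.Icc 1 (m / 2) = insert 1 (Finset.Icc 2 (m / 2)) := by
    ext k
    simp only [Finset.mem_Icc, Finset.mem_insert]
    omega
  have h1Icc : 1 ∉ Finset.Icc 2 (m / 2) := by simp
  refine torusExtremal_eq_half_mul_sSup (fun f hf => le_sSup ?_) ?_
  -- The weights come from folding one period; at `k = m / 2` there is no partner.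
  · let c : ℕ → ℝ := fun k => (if 2 * k = m then 1 else 2) * f ((k : ℤ) • z)
    have hc {k : ℕ} (hk : k ∈ Finset.Icc 2 (m / 2)) (hkH : k ∉ H) : c k = 0 := by
      have : f ((k : ℤ) • z) = 0 := by
        refine hf.eq_zero_of_notMem fun h => hkH ?_
        have hk' := Finset.mem_Icc.mp hk
        exact mem_truncatedMultipleIndexSet hk'.1 hk'.2 (by simpa using h.1) (by simpa using h.2)
      simp only [c, this, mul_zero]
    let φ : UnitAddCircle → ℝ := fun t =>
      1 + ∑ k ∈ Finset.Icc 1 (m / 2), c k * (fourier (k : ℤ) t).re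
    have hc1 : c 1 = 2 * f z := by
      simp only [c]
      rw [if_neg (by omega), Nat.cast_one, one_smul]
    refine ⟨φ, 2 * f z, c, ⟨fun t => ?_, fun j => ?_⟩, rfl⟩
    · have := hasSum_subtype_of_subset_Icc hHsub fun k => c k * Real.cos (2 * Real.pi * k * t)
      convert! this using 1
      simp only [φ, fourier_coe_re]
      rw [hIcc, Finset.sum_insert h1Icc, hc1]
      have : ∑ k ∈ Finset.Icc 2 (m / 2), c k * Real.cos (2 * Real.pi * k * t) =
          ∑ k ∈ Finset.Icc 2 (m / 2),
            H.indicator (fun k => c k * Real.cos (2 * Real.pi * k * t)) k := by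
        refine Finset.sum_congr rfl fun k hk => ?_
        by_cases hkH : k ∈ H
        · rw [Set.indicator_of_mem hkH]
        · rw [Set.indicator_of_notMem hkH, hc hk hkH, zero_mul]
      rw [this]
      simp
    · set t : UnitAddCircle := (((j : ℝ) / (m : ℝ) : ℝ) : UnitAddCircle)
      have ht : m • t = 0 := by
        rw [← AddCircle.coe_nsmul, nsmul_eq_mul, mul_div_cancel₀ _ (by positivity)]
        exact (AddCircle.coe_eq_zero_iff 1).mpr ⟨j, by simp⟩
      let g : ℤ → ℝ := fun k => f (k • z) * (fourier k t).re
      have hper (k : ℤ) : g (k + m) = g k := by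
        simp only [g, fourier_re_add_order ht, add_smul, natCast_zsmul, hmz, add_zero]
      have heven (k : ℤ) : g (-k) = g k := by
        simp only [g, neg_smul, hf.map_neg, fourier_neg, Complex.conj_re]
      have h := hf.sum_sum_zsmul_mul_re_nonneg z m t
      rw [sum_sum_sub_of_periodic (g := g) hper,
        sum_range_of_even_of_periodic (by omega) heven hper] at h
      have h' := nonneg_of_mul_nonneg_right h (by positivity)
      refine h'.trans_eq ?_
      simp only [φ, c, g, zero_smul, hf.map_zero, fourier_zero, Complex.one_re, mul_one, mul_assoc]
  · rintro x ⟨φ, lam, c, hφ, rfl⟩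
    refine ⟨lam, rfl, ?_⟩
    let C : ℕ → ℝ := fun k => if k = 1 then lam else c k
    let K : Finset ℕ := {k ∈ Finset.Icc 1 (m / 2) | k = 1 ∨ k ∈ H}
    have hkm {k} (hk : k ∈ K) : 1 ≤ k ∧ k ≤ m / 2 :=
      Finset.mem_Icc.mp (Finset.mem_filter.mp hk).1
    have hzero {k : ℤ} (hk : k • z = 0) : (m : ℤ) ∣ k := by
      rw [← ho]
      exact addOrderOf_dvd_iff_zsmul_eq_zero.mpr hk
    have hzero' {k : ℤ} (hk : k • z = 0) (hpos : 0 < k) : m ≤ k :=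
      Int.le_of_dvd hpos (hzero hk)
    have hex : ∃ f, IsTorusAdmissible Ω f ∧
        (1 ∈ K → f z = C 1 / 2 * (1 + if -z = z then 1 else 0)) := by
      refine exists_isTorusAdmissible hΩ h0 z K C ?_ ?_ ?_ ?_
      · intro k hk
        rcases (Finset.mem_filter.mp hk).2 with rfl | h
        · simpa using hz
        · exact h.1.2
      · intro k hk h
        have := hkm hk
        have := hzero' (k := k) (by simpa using h) (by omega)
        omega
      · intro k hk hne
        have := hkm hk
        refine ⟨fun h => ?_, fun h => ?_⟩
        -- Since `2 ≤ k ≤ m / 2` and `m ≥ 3`, both `k - 1` and `k + 1` lie strictly between `0` and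
        -- `m`.
        · have := hzero' (k := k - 1) (by simpa [sub_smul, sub_eq_zero] using h) (by omega)
          omega
        · have := hzero' (k := k + 1) (by
            rw [add_smul, one_smul, natCast_zsmul]; nth_rw 2 [← h]; exact add_neg_cancel _)
            (by omega)
          omega
      · intro n
        -- The angles of `z` are `m`-torsion, hence of the form `j / m`, exactly where `φ` is known
        -- to be nonnegative.
        have ht : m • angle n z = 0 := by rw [← map_nsmul, hmz, map_zero]
        obtain ⟨j, -, hj⟩ := (AddCircle.nsmul_eq_zero_iff (by omega)).mp ht
        rw [mul_one] at hj
        rw [← hj]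
        have hs := hφ.hasSum ((j : ℝ) / m)
        have hs' := hs.unique (hasSum_subtype_of_subset_Icc hHsub
          fun k => c k * Real.cos (2 * Real.pi * k * ((j : ℝ) / m)))
        have hnn := hφ.nonneg j
        rw [Int.cast_natCast, ← sub_add_cancel (φ _) (1 + lam * Real.cos (2 * Real.pi * ((j : ℝ) / m))),
          hs'] at hnn
        refine hnn.trans_eq ?_
        rw [Finset.sum_filter, hIcc, Finset.sum_insert h1Icc, if_pos (Or.inl rfl), add_comm,
          add_assoc]
        congr 2
        · simp only [C, fourier_coe_re]
          simp
        · refine Finset.sum_congr rfl fun k hk => ?_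
          have hk1 : k ≠ 1 := fun h => h1Icc (h ▸ hk)
          simp only [C, fourier_coe_re, hk1, false_or, if_false]
          rfl
    obtain ⟨f, hf, hfz⟩ := hex
    refine le_trans (le_of_eq ?_) (le_torusExtremal hf z)
    have hne : -z ≠ z := by
      intro h
      have := hzero' (k := 2) (by rw [two_smul]; nth_rw 1 [← h]; exact neg_add_cancel z)
        (by norm_num)
      omega
    rw [hfz (by simp [K]; omega), if_neg hne]
    simp [C]


/-- An infinite cyclic group has only two generators, inverse to each other; evenness of `f` then
identifies the two values. -/
theorem eq_or_eq_neg_of_torusOrbit_eq {z z' : UnitAddTorus (Fin d)}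
    (hinf : (torusOrbit z).Infinite) (h : torusOrbit z' = torusOrbit z) : z' = z ∨ z' = -z := by
  obtain ⟨a, ha⟩ : z' ∈ torusOrbit z := h ▸ ⟨1, one_smul ℤ z'⟩
  obtain ⟨b, hb⟩ : z ∈ torusOrbit z' := h ▸ ⟨1, one_smul ℤ z⟩
  simp only at ha hb
  have hab : b * a - 1 = 0 := zsmul_eq_zero_of_infinite_torusOrbit hinf (by
    rw [sub_smul, mul_smul, ha, hb, one_smul, sub_self])
  rcases Int.isUnit_iff.mp (IsUnit.of_mul_eq_one b (show a * b = 1 by linarith)) with rfl | rfl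
  · exact Or.inl (by simpa using ha.symm)
  · exact Or.inr (by simpa using ha.symm)

theorem nsmul_mem_iff_of_trace_eq {Ω Ω' : Set (UnitAddTorus (Fin d))} {z : UnitAddTorus (Fin d)}
    (h : Ω' ∩ -Ω' ∩ torusOrbit z = Ω ∩ -Ω ∩ torusOrbit z) (k : ℕ) :
    (k • z ∈ Ω' ∧ -(k • z) ∈ Ω') ↔ (k • z ∈ Ω ∧ -(k • z) ∈ Ω) := by
  have hk : k • z ∈ torusOrbit z := ⟨k, natCast_zsmul z k⟩
  have := Set.ext_iff.mp h (k • z)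
  simpa [hk] using this

theorem multipleIndexSet_eq_of_trace_eq {Ω Ω' : Set (UnitAddTorus (Fin d))}
    {z : UnitAddTorus (Fin d)} (h : Ω' ∩ -Ω' ∩ torusOrbit z = Ω ∩ -Ω ∩ torusOrbit z) :
    multipleIndexSet Ω' z = multipleIndexSet Ω z := by
  ext k
  exact and_congr_right fun _ => nsmul_mem_iff_of_trace_eq h k

end

/-! ### Assembly of the theorem -/

theorem mainTheorem2 (d : ℕ) (Ω : Set (UnitAddTorus (Fin d))) (hΩ : IsOpen Ω)
    (h0 : (0 : UnitAddTorus (Fin d)) ∈ Ω) (z : UnitAddTorus (Fin d)) (hz : z ∈ Ω ∩ (-Ω)) :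
    -- the value depends on the symmetrized domain only through its trace on the orbit
    (∀ Ω' : Set (UnitAddTorus (Fin d)), IsOpen Ω' →
      Ω' ∩ (-Ω') ∩ torusOrbit z = Ω ∩ (-Ω) ∩ torusOrbit z →
      torusExtremal Ω' z = torusExtremal Ω z) ∧
    -- an infinite orbit determines the value for the given domain
    ((torusOrbit z).Infinite → ∀ z' : UnitAddTorus (Fin d), torusOrbit z' = torusOrbit z →
      torusExtremal Ω z' = torusExtremal Ω z) ∧
    -- infinite orbit
    ((torusOrbit z).Infinite →
      torusExtremal Ω z = ((1 / 2 : ℝ) : EReal) * trigExtremal (multipleIndexSet Ω z)) ∧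
    -- finite orbit
    (∀ m : ℕ, 3 ≤ m → (torusOrbit z).encard = m →
      torusExtremal Ω z =
        ((1 / 2 : ℝ) : EReal) * trigExtremalDiscrete m (truncatedMultipleIndexSet m Ω z)) ∧
    -- the degenerate orbits `{0}` and `{0, z}`, `2 z = 0`
    ((torusOrbit z).encard ≤ 2 → torusExtremal Ω z = 1) := by
  refine ⟨fun Ω' hΩ' h => ?_, fun hinf z' h => ?_, torusExtremal_of_infinite hΩ h0 hz,
    fun m hm hzm => torusExtremal_of_addOrderOf hΩ h0 hz hm (addOrderOf_eq_of_encard_torusOrbit hzm),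
    fun h => torusExtremal_eq_one hΩ h0 hz (neg_eq_self_of_encard_torusOrbit_le_two h)⟩
  -- Both `0` and `z` lie on the orbit, so equality of traces makes the value formulas available for
  -- `Ω'` as well.
  · have h0' : (0 : UnitAddTorus (Fin d)) ∈ Ω' := by
      simpa [h0] using nsmul_mem_iff_of_trace_eq h 0
    have hz' : z ∈ Ω' ∩ -Ω' := by
      have := (nsmul_mem_iff_of_trace_eq h 1).mpr (by simpa using hz)
      simpa using this
    have hH := multipleIndexSet_eq_of_trace_eq h
    by_cases hinf : (torusOrbit z).Infinite
    · rw [torusExtremal_of_infinite hΩ h0 hz hinf, torusExtremal_of_infinite hΩ' h0' hz' hinf, hH]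
    · obtain ⟨m, hm⟩ := ENat.ne_top_iff_exists.mp
        (Set.encard_ne_top_iff.mpr (Set.not_infinite.mp hinf))
      by_cases hm3 : 3 ≤ m
      · have ho := addOrderOf_eq_of_encard_torusOrbit hm.symm
        rw [torusExtremal_of_addOrderOf hΩ h0 hz hm3 ho,
          torusExtremal_of_addOrderOf hΩ' h0' hz' hm3 ho]
        simp only [truncatedMultipleIndexSet, hH]
      · have h2 : -z = z := neg_eq_self_of_encard_torusOrbit_le_two (by
          rw [← hm]
          exact_mod_cast (show m ≤ 2 by omega))
        rw [torusExtremal_eq_one hΩ h0 hz h2, torusExtremal_eq_one hΩ' h0' hz' h2]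
  · rcases eq_or_eq_neg_of_torusOrbit_eq hinf h with rfl | rfl
    · rfl
    · exact torusExtremal_neg Ω z
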